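/- Let $n\ge 0$ be an integer and let $P,Q\in\mathbb{R}^{n\times n}[\xi]$ be real polynomial matrices with $\operatorname{normalrank}\,[P\ \ {-Q}]=n$, where $\operatorname{normalrank}(G)=\max_{\lambda\in\mathbb{C}}\operatorname{rank}G(\lambda)$. Let $$\mathcal{B}=\{(\mathbf{i},\mathbf{v})\in L_1^{\mathrm{loc}}(\mathbb{R},\mathbb{R}^n)\times L_1^{\mathrm{loc}}(\mathbb{R},\mathbb{R}^n)\;:\;P(\tfrac{d}{dt})\mathbf{i}=Q(\tfrac{d}{dt})\mathbf{v}\},$$ where the equation is understood in the weak (distributional) sense and functions that agree almost everywhere are identified. Let $\mathcal{D}_+(\mathbb{R},\mathbb{R}^n)$ be the space of infinitely differentiable functions $\mathbb{R}\to\mathbb{R}^n$ whose support is bounded on the left, and for $\mathbf{w}_1,\mathbf{w}_2\in\mathcal{D}_+(\mathbb{R},\mathbb{R}^n)$ put $(\mathbf{w}_1\star\mathbf{w}_2)(t)=\int_{-\infty}^{\infty}\mathbf{w}_1(\tau)^T\mathbf{w}_2(t-\tau)\,d\tau$. Then the following three conditions are equivalent. 1. $\mathcal{B}$ is reciprocal,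 that is, $\mathbf{v}_b\star\mathbf{i}_a=\mathbf{i}_b\star\mathbf{v}_a$ for all $(\mathbf{i}_a,\mathbf{v}_a),(\mathbf{i}_b,\mathbf{v}_b)\in\mathcal{B}\cap(\mathcal{D}_+(\mathbb{R},\mathbb{R}^n)\times\mathcal{D}_+(\mathbb{R},\mathbb{R}^n))$. 2. $PQ^T=QP^T$. 3. There exist an integer $0\le r\le n$ and real matrices $T_1\in\mathbb{R}^{r\times n}$, $T_2\in\mathbb{R}^{(n-r)\times n}$ such that $\begin{bmatrix}T_1\\T_2\end{bmatrix}$ is a permutation matrix, and there exist $\hat P,\hat Q\in\mathbb{R}^{n\times n}[\xi]$ with $\det\hat Q\ne 0$ and $\hat Q^{-1}\hat P$ proper (every entry is bounded at infinity) and symmetric, such that the projected behavior $$\hat{\mathcal{B}}=\left\{\left(\begin{bmatrix}T_1\mathbf{i}\\-T_2\mathbf{v}\end{bmatrix},\begin{bmatrix}T_1\mathbf{v}\\T_2\mathbf{i}\end{bmatrix}\right)\;:\;(\mathbf{i},\mathbf{v})\in\mathcal{B}\right\}$$ satisfies $$\hat{\mathcal{B}}=\{(\mathbf{u},\mathbf{y})\in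 L_1^{\mathrm{loc}}(\mathbb{R},\mathbb{R}^n)\times L_1^{\mathrm{loc}}(\mathbb{R},\mathbb{R}^n)\;:\;\hat P(\tfrac{d}{dt})\mathbf{u}=\hat Q(\tfrac{d}{dt})\mathbf{y}\}$$ (again in the weak sense). -/

import Mathlib

open Polynomial MeasureTheory Matrix
open scoped ContDiff

namespace Behavioral

/-- The normal rank of a real polynomial matrix `G`: the maximum over `z ∈ ℂ` of the rank of the
complex matrix `G(z)`. (The set of these ranks is a nonempty set of naturals bounded by the number
of columns, so that the supremum is a maximum.) -/
noncomputable def normalRank {κ ι : Type*} [Fintype ι] (G : Matrix κ ι ℝ[X]) : ℕ :=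
  ⨆ z : ℂ, (G.map fun p => aeval z p).rank

/-- A rational function is proper (bounded at infinity) if the degree of its numerator does not
exceed that of its denominator. -/
def IsProper (f : RatFunc ℝ) : Prop := f.num.degree ≤ f.denom.degree

/-- The rational matrix `Q⁻¹ P` of two square polynomial matrices, meant for nonsingular `Q`. -/
noncomputable def transferMatrix {ι : Type*} [Fintype ι] [DecidableEq ι]
    (P Q : Matrix ι ι ℝ[X]) : Matrix ι ι (RatFunc ℝ) :=
  (Q.map (algebraMap ℝ[X] (RatFunc ℝ)))⁻¹ * P.map (algebraMap ℝ[X] (RatFunc ℝ))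

/-- Test functions on the real line. -/
def IsTestFunction (φ : ℝ → ℝ) : Prop := ContDiff ℝ ∞ φ ∧ HasCompactSupport φ

/-- `adjointOp p φ = p(-d/dt) φ`, the formal adjoint of `p(d/dt)` applied to `φ`. -/
noncomputable def adjointOp (p : ℝ[X]) (φ : ℝ → ℝ) (t : ℝ) : ℝ :=
  p.sum fun k a => a * (-1) ^ k * iteratedDeriv k φ t

/-- The value of the vector-valued distribution `R(d/dt) w` at the test function `φ`, where `R` is
a polynomial matrix and `w` is locally integrable: its `k`-th entry is
`∑ j, ∫ w_j(t) (R_{kj}(-d/dt) φ)(t) dt`. -/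
noncomputable def distApply {κ ι : Type*} [Fintype ι] (R : Matrix κ ι ℝ[X]) (w : ℝ → ι → ℝ)
    (φ : ℝ → ℝ) : κ → ℝ :=
  fun k => ∑ j, ∫ t, w t j * adjointOp (R k j) φ t

/-- The behavior of all pairs `(i, v)` of locally integrable functions that solve
`P(d/dt) i = Q(d/dt) v` weakly, i.e. in the sense of distributions. It is a set of functions that
is invariant under changes on null sets. -/
def behavior {κ ι : Type*} [Fintype ι] (P Q : Matrix κ ι ℝ[X]) :
    Set ((ℝ → ι → ℝ) × (ℝ → ι → ℝ)) :=
  {w | LocallyIntegrable w.1 ∧ LocallyIntegrable w.2 ∧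
    ∀ φ, IsTestFunction φ → distApply P w.1 φ = distApply Q w.2 φ}

/-- Smooth functions with support bounded on the left (the space `𝓓₊`). -/
def IsDPlus {ι : Type*} [Fintype ι] (w : ℝ → ι → ℝ) : Prop :=
  ContDiff ℝ ∞ w ∧ BddBelow (Function.support w)

/-- The convolution `(w₁ ⋆ w₂)(t) = ∫ w₁(τ)ᵀ w₂(t - τ) dτ`. -/
noncomputable def conv {ι : Type*} [Fintype ι] (w₁ w₂ : ℝ → ι → ℝ) (t : ℝ) : ℝ :=
  ∫ τ, w₁ τ ⬝ᵥ w₂ (t - τ)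

/-- `B` is reciprocal if `v_b ⋆ i_a = i_b ⋆ v_a` for all its trajectories `(i_a, v_a)` and
`(i_b, v_b)` in `𝓓₊ × 𝓓₊`. -/
def IsReciprocal {ι : Type*} [Fintype ι] (B : Set ((ℝ → ι → ℝ) × (ℝ → ι → ℝ))) : Prop :=
  ∀ iₐ vₐ i_b v_b : ℝ → ι → ℝ,
    (iₐ, vₐ) ∈ B → IsDPlus iₐ → IsDPlus vₐ →
    (i_b, v_b) ∈ B → IsDPlus i_b → IsDPlus v_b →
    conv v_b iₐ = conv i_b vₐ

/-- The projection of `B` onto `u = col(T₁ i, -T₂ v)` and `y = col(T₁ v, T₂ i)`. -/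
def projection {ι α β : Type*} [Fintype ι] (T₁ : Matrix α ι ℝ) (T₂ : Matrix β ι ℝ)
    (B : Set ((ℝ → ι → ℝ) × (ℝ → ι → ℝ))) :
    Set ((ℝ → α ⊕ β → ℝ) × (ℝ → α ⊕ β → ℝ)) :=
  {uy | ∃ i v : ℝ → ι → ℝ, (i, v) ∈ B ∧
    uy.1 = (fun t => Sum.elim (T₁ *ᵥ i t) (-(T₂ *ᵥ v t))) ∧
    uy.2 = (fun t => Sum.elim (T₁ *ᵥ v t) (T₂ *ᵥ i t))}

/-- A permutation matrix whose rows and columns may carry different index types: the 0-1 matrix of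
a bijection between them. -/
def IsPermutationMatrix {α ι : Type*} [DecidableEq ι] (T : Matrix α ι ℝ) : Prop :=
  ∃ σ : α ≃ ι, T = σ.toPEquiv.toMatrix

end Behavioral

/-!
The proof runs through the implications from reciprocity to `P Qᵀ = Q Pᵀ`, from there to the
description of the projected behavior, and back to reciprocity.

The analysis is confined to one observation. The space `𝓓₊` of scalar smooth functions with support
bounded on the left is an `ℝ[X]`-module, with `X` acting as `d/dt`. It is torsion-free, because a
solution of a linear differential equation that vanishes far to the left is zero
(`eq_zero_of_poly_smul_eq_zero`), and convolution is `ℝ[X]`-bilinear on it (`dPlusConv`). The weak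
equation `P(d/dt) i = Q(d/dt) v` in `𝓓₊` is an equation in this module
(`trajectory_mem_behavior_iff`), so that what remains is algebra.

*Reciprocity implies symmetry.* A polynomial vector `(M, L)` in the kernel of `[P  -Q]` and
`f ∈ 𝓓₊` give the trajectory `(M f, L f)`. Reciprocity for such trajectories says that the kernel is
isotropic for the standard symplectic form (`IsReciprocal.dotProduct_eq`). Over the field of
rational functions its dimension is at least half of that of the space, hence it is Lagrangian and
contains the columns of `col(Qᵀ, Pᵀ)`, which means `P Qᵀ = Q Pᵀ`
(`mul_transpose_comm_of_isotropic`).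

*Symmetry implies a proper symmetric description.* Let `P_S`, `Q_S` arise from `P`, `Q` by
exchanging the columns outside of `S`, with a sign. Some `Q_S` is nonsingular: up to powers of `i`,
the determinants of these matrices are the terms in the multilinear expansion of `det (Q + iP)`, and
this is not zero because `(Q + iP) (Q + iP)ᴴ = Q Qᵀ + P Pᵀ` on the real axis
(`exists_det_swapRight_ne_zero`). Take `S` with `det Q_S` of maximal degree. The symmetry of
`H = Q_S⁻¹ P_S` is inherited from `P Qᵀ = Q Pᵀ`. The principal minors of `H` are, up to sign,
quotients `det Q_{S'} / det Q_S`, hence proper; those of order one are the diagonal entries, and by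
those of order two the squares of the other entries are proper too (`exists_swap_isProper`). The
exchange of columns is exactly what the projection does to the behavior (`projection_behavior`).

*A symmetric description implies reciprocity.* In the projected behavior `det Q' • y = S u` with the
symmetric polynomial matrix `S = adj(Q') P'`, and `S` can be moved from one factor of a convolution
to the other. Cancelling `det Q'` in the torsion-free module `𝓓₊` gives reciprocity of the projected
behavior (`isReciprocal_of_isSymm`), and the relabelling of signals turns it into reciprocity of the
behavior itself (`IsReciprocal.of_projection`).
-/

namespace Behavioral

/-! ### Lagrangian subspaces -/

section LinearAlgebra

variable {ι : Type*} [Fintype ι]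

/-- The standard symplectic form on `Kⁿ × Kⁿ`. -/
def symplecticForm (K ι : Type*) [Field K] [Fintype ι] :
    LinearMap.BilinForm K ((ι → K) × (ι → K)) :=
  LinearMap.mk₂ K (fun a b => a.2 ⬝ᵥ b.1 - a.1 ⬝ᵥ b.2)
    (fun a a' b => by simp only [Prod.fst_add, Prod.snd_add, add_dotProduct]; ring)
    (fun c a b => by simp only [Prod.smul_fst, Prod.smul_snd, smul_dotProduct, smul_eq_mul]; ring)
    (fun a b b' => by simp only [Prod.fst_add, Prod.snd_add, dotProduct_add]; ring)
    (fun c a b => by simp only [Prod.smul_fst, Prod.smul_snd, dotProduct_smul, smul_eq_mul]; ring)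

lemma symplecticForm_apply {K : Type*} [Field K] (a b : (ι → K) × (ι → K)) :
    symplecticForm K ι a b = a.2 ⬝ᵥ b.1 - a.1 ⬝ᵥ b.2 := rfl

lemma symplecticForm_nondegenerate (K ι : Type*) [Field K] [Fintype ι] :
    (symplecticForm K ι).Nondegenerate := by
  constructor
  · intro a ha
    refine Prod.ext (dotProduct_eq_zero_iff.mp fun w => ?_) (dotProduct_eq_zero_iff.mp fun w => ?_)
    · simpa [symplecticForm_apply] using ha (0, w)
    · simpa [symplecticForm_apply] using ha (w, 0)
  · intro a ha
    refine Prod.ext (dotProduct_eq_zero_iff.mp fun w => ?_) (dotProduct_eq_zero_iff.mp fun w => ?_)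
    · simpa [symplecticForm_apply, dotProduct_comm] using ha (0, w)
    · simpa [symplecticForm_apply, dotProduct_comm] using ha (w, 0)

/-- If the kernel of `[P  -Q]` is isotropic for the symplectic form, it is Lagrangian, because its
dimension is at least half of that of the space. It then contains the columns of
`col(Qᵀ, Pᵀ)`, which are always orthogonal to it. -/
lemma mul_transpose_comm_of_isotropic {K : Type*} [Field K] (P Q : Matrix ι ι K)
    (h : ∀ i v i' v' : ι → K, P *ᵥ i = Q *ᵥ v → P *ᵥ i' = Q *ᵥ v' → v' ⬝ᵥ i = i' ⬝ᵥ v) :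
    P * Qᵀ = Q * Pᵀ := by
  classical
  let f : ((ι → K) × (ι → K)) →ₗ[K] (ι → K) :=
    P.mulVecLin ∘ₗ LinearMap.fst K _ _ - Q.mulVecLin ∘ₗ LinearMap.snd K _ _
  have hf : ∀ w, w ∈ LinearMap.ker f ↔ P *ᵥ w.1 = Q *ᵥ w.2 := fun w => by
    simp [f, sub_eq_zero]
  set W := LinearMap.ker f with hW
  have hdim : Module.finrank K ((ι → K) × (ι → K)) = Fintype.card ι + Fintype.card ι := by simp
  have h1 : _ + Module.finrank K W = _ := f.finrank_range_add_finrank_ker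
  have h2 : Module.finrank K (LinearMap.range f) ≤ Fintype.card ι := by
    simpa using (LinearMap.range f).finrank_le
  have h3 := LinearMap.BilinForm.finrank_orthogonal (symplecticForm_nondegenerate K ι) W
  have hle : W ≤ (symplecticForm K ι).orthogonal W := by
    intro a ha b hb
    rw [hf] at ha hb
    change symplecticForm K ι b a = 0
    rw [symplecticForm_apply, sub_eq_zero]
    exact h _ _ _ _ ha hb
  have heq : W = (symplecticForm K ι).orthogonal W :=
    Submodule.eq_of_le_of_finrank_le hle (by omega)
  ext k l
  have hmem : ((fun j => Q l j, fun j => P l j) : (ι → K) × (ι → K)) ∈ W := by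
    rw [heq, LinearMap.BilinForm.mem_orthogonal_iff]
    intro w hw
    rw [hf] at hw
    rw [symplecticForm_apply, sub_eq_zero, dotProduct_comm, dotProduct_comm w.1]
    exact (congrFun hw l).symm
  rw [hf] at hmem
  exact congrFun hmem k

end LinearAlgebra

/-! ### Full normal row rank -/

section NormalRank

variable {n : ℕ}

/-- Full normal row rank makes the rows of `[P  -Q]` independent over `ℂ[X]`: at a point of maximal
rank there is a constant matrix `Y` for which `det ([P  -Q] Y)` does not vanish identically. -/
lemma eq_zero_of_vecMul_eq_zero (P Q : Matrix (Fin n) (Fin n) ℝ[X])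
    (hrank : normalRank (Matrix.fromCols P (-Q)) = n) (x : Fin n → ℂ[X])
    (hP : x ᵥ* P.map (mapRingHom (algebraMap ℝ ℂ)) = 0)
    (hQ : x ᵥ* Q.map (mapRingHom (algebraMap ℝ ℂ)) = 0) : x = 0 := by
  set R := Matrix.fromCols P (-Q) with hR
  obtain ⟨z, hz⟩ : ∃ z : ℂ, (R.map fun p => aeval z p).rank = n := by
    have hbdd : BddAbove (Set.range fun z : ℂ => (R.map fun p => aeval z p).rank) :=
      ⟨Fintype.card (Fin n), by rintro _ ⟨z, rfl⟩; exact Matrix.rank_le_card_height _⟩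
    have := Nat.sSup_mem (Set.range_nonempty _) hbdd
    obtain ⟨z, hz⟩ := this
    exact ⟨z, hz.trans hrank⟩
  have hsurj : Function.Surjective (R.map fun p => aeval z p).mulVec := by
    have : LinearMap.range (R.map fun p => aeval z p).mulVecLin = ⊤ := by
      apply Submodule.eq_top_of_finrank_eq
      rw [← Matrix.rank, hz]; simp
    exact LinearMap.range_eq_top.mp this
  obtain ⟨Y, hY⟩ := Matrix.mulVec_surjective_iff_exists_right_inverse.mp hsurj
  set RC := R.map (mapRingHom (algebraMap ℝ ℂ)) with hRC
  have hx : x ᵥ* RC = 0 := by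
    have : RC = Matrix.fromCols (P.map (mapRingHom (algebraMap ℝ ℂ)))
        (-(Q.map (mapRingHom (algebraMap ℝ ℂ)))) := by
      ext i (j | j) <;> simp [hRC, hR]
    rw [this, Matrix.vecMul_fromCols, hP, Matrix.vecMul_neg, hQ]
    ext (j | j) <;> simp
  have hdet : (RC * Y.map C).det ≠ 0 := by
    intro h0
    have h1 : (RC * Y.map C).map (evalRingHom z) = 1 := by
      rw [Matrix.map_mul, ← hY]
      congr 1
      · ext i j
        simp [hRC, aeval_def, eval_map]
      · ext i j
        simp
    have h2 := congrArg (evalRingHom z) h0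
    rw [RingHom.map_det, RingHom.mapMatrix_apply, h1] at h2
    simp at h2
  by_contra hne
  exact hdet (Matrix.exists_vecMul_eq_zero_iff.mp
    ⟨x, hne, by rw [← Matrix.vecMul_vecMul, hx, Matrix.zero_vecMul]⟩)

end NormalRank

/-! ### Exchange of columns -/

section Swap

variable {ι : Type*} [DecidableEq ι]

/-- `swapLeft S P Q` is the matrix whose columns with index in `S` are those of `P` and whose other
columns are those of `Q`. -/
def swapLeft {κ R : Type*} (S : Finset ι) (P Q : Matrix κ ι R) : Matrix κ ι R :=
  Matrix.of fun k j => if j ∈ S then P k j else Q k j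

/-- `swapRight S P Q` is the matrix whose columns with index in `S` are those of `Q` and whose
other columns are those of `-P`. -/
def swapRight {κ R : Type*} [Neg R] (S : Finset ι) (P Q : Matrix κ ι R) : Matrix κ ι R :=
  Matrix.of fun k j => if j ∈ S then Q k j else -P k j

lemma swap_mul_transpose [Fintype ι] {κ R : Type*} [CommRing R] (S : Finset ι)
    (P Q : Matrix κ ι R) (h : P * Qᵀ = Q * Pᵀ) :
    swapLeft S P Q * (swapRight S P Q)ᵀ = swapRight S P Q * (swapLeft S P Q)ᵀ := by
  rw [← sub_eq_zero] at h ⊢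
  rw [← h]
  ext k l
  simp only [Matrix.sub_apply, Matrix.mul_apply, Matrix.transpose_apply, swapLeft, swapRight,
    Matrix.of_apply, ← Finset.sum_sub_distrib]
  refine Finset.sum_congr rfl fun j _ => ?_
  split_ifs <;> ring

/-- Replacing the columns of `swapRight S P Q` with index in `T` by those of `swapLeft S P Q`
gives, up to sign, a matrix of the same kind. -/
lemma swapRight_symmDiff [Fintype ι] {κ R : Type*} [CommRing R] (S T : Finset ι)
    (P Q : Matrix κ ι R) :
    swapRight (symmDiff S T) P Q =
      swapLeft T (swapLeft S P Q) (swapRight S P Q) *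
        Matrix.diagonal (fun j => if j ∈ S ∧ j ∈ T then (-1 : R) else 1) := by
  ext k j
  rw [Matrix.mul_diagonal]
  by_cases hS : j ∈ S <;> by_cases hT : j ∈ T <;>
    simp [swapRight, swapLeft, Finset.mem_symmDiff, hS, hT]

lemma natDegree_det_swapRight_symmDiff [Fintype ι] (S T : Finset ι) (P Q : Matrix ι ι ℝ[X]) :
    (swapRight (symmDiff S T) P Q).det.natDegree =
      (swapLeft T (swapLeft S P Q) (swapRight S P Q)).det.natDegree := by
  rw [swapRight_symmDiff, Matrix.det_mul, Matrix.det_diagonal]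
  have : ∏ j, (if j ∈ S ∧ j ∈ T then (-1 : ℝ[X]) else 1) = 1 ∨
      ∏ j, (if j ∈ S ∧ j ∈ T then (-1 : ℝ[X]) else 1) = -1 := by
    refine Finset.prod_induction _ (fun x : ℝ[X] => x = 1 ∨ x = -1) ?_ (Or.inl rfl) ?_
    · rintro a b (rfl | rfl) (rfl | rfl) <;> simp
    · intro j _
      split_ifs <;> simp
  rcases this with h | h <;> rw [h] <;> simp

end Swap

/-! ### Existence of a nonsingular exchange -/

section Nonsingular

variable {n : ℕ}

/-- If `A + iB` kills the row vector `x`, where `A Bᵀ = B Aᵀ` are real matrices, then so do `A` and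
`B`. -/
lemma vecMul_eq_zero_of_add_I_smul {ι : Type*} [Fintype ι] (A B : Matrix ι ι ℝ)
    (h : A * Bᵀ = B * Aᵀ) (x : ι → ℂ)
    (hx : x ᵥ* A.map (algebraMap ℝ ℂ) + Complex.I • (x ᵥ* B.map (algebraMap ℝ ℂ)) = 0) :
    x ᵥ* A.map (algebraMap ℝ ℂ) = 0 ∧ x ᵥ* B.map (algebraMap ℝ ℂ) = 0 := by
  set A' := A.map (algebraMap ℝ ℂ) with hA'
  set B' := B.map (algebraMap ℝ ℂ) with hB'
  have hAH : A'ᴴ = A'ᵀ := by ext i j; simp [hA', Matrix.conjTranspose_apply]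
  have hBH : B'ᴴ = B'ᵀ := by ext i j; simp [hB', Matrix.conjTranspose_apply]
  have h' : A' * B'ᵀ = B' * A'ᵀ := by
    have := congrArg (fun M : Matrix ι ι ℝ => M.map (algebraMap ℝ ℂ)) h
    simpa only [Matrix.map_mul, Matrix.transpose_map] using this
  have hu : x ᵥ* A' = -(Complex.I • (x ᵥ* B')) := eq_neg_of_add_eq_zero_left hx
  have e1 : (x ᵥ* A') ⬝ᵥ star (x ᵥ* B') = (x ᵥ* B') ⬝ᵥ star (x ᵥ* A') := by
    rw [Matrix.star_vecMul, Matrix.star_vecMul, hAH, hBH, Matrix.dotProduct_mulVec,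
      Matrix.vecMul_vecMul, h', ← Matrix.vecMul_vecMul, ← Matrix.dotProduct_mulVec]
  rw [hu] at e1
  have e2 : (2 * Complex.I) * ((x ᵥ* B') ⬝ᵥ star (x ᵥ* B')) = 0 := by
    simp only [neg_dotProduct, smul_dotProduct, star_neg, star_smul, dotProduct_neg,
      dotProduct_smul, smul_eq_mul, Complex.star_def, Complex.conj_I] at e1
    linear_combination -e1
  have hB0 : x ᵥ* B' = 0 := by
    rcases mul_eq_zero.mp e2 with h0 | h0
    · simp at h0
    · open scoped ComplexOrder in
      exact dotProduct_star_self_eq_zero.mp ((dotProduct_comm _ _).trans h0)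
  exact ⟨by rw [hu, hB0]; simp, hB0⟩

/-- `det (Q + iP)` does not vanish identically, because on the real axis
`(Q + iP) (Q + iP)ᴴ = Q Qᵀ + P Pᵀ`. -/
lemma det_add_I_smul_ne_zero (P Q : Matrix (Fin n) (Fin n) ℝ[X])
    (hrank : normalRank (Matrix.fromCols P (-Q)) = n) (h : P * Qᵀ = Q * Pᵀ) :
    (Q.map (mapRingHom (algebraMap ℝ ℂ)) +
      (C Complex.I) • P.map (mapRingHom (algebraMap ℝ ℂ))).det ≠ 0 := by
  intro h0
  obtain ⟨x, hx0, hx⟩ := Matrix.exists_vecMul_eq_zero_iff.mpr h0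
  have key : ∀ t : ℝ, ∀ j,
      ((x ᵥ* Q.map (mapRingHom (algebraMap ℝ ℂ))) j).eval (t : ℂ) = 0 ∧
      ((x ᵥ* P.map (mapRingHom (algebraMap ℝ ℂ))) j).eval (t : ℂ) = 0 := by
    intro t
    have ev : ∀ (M : Matrix (Fin n) (Fin n) ℝ[X]) (j : Fin n),
        ((x ᵥ* M.map (mapRingHom (algebraMap ℝ ℂ))) j).eval (t : ℂ) =
        ((fun i => (x i).eval (t : ℂ)) ᵥ*
          (M.map (evalRingHom t)).map (algebraMap ℝ ℂ)) j := by
      intro M j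
      simp only [Matrix.vecMul, dotProduct, eval_finsetSum, eval_mul, Matrix.map_apply,
        coe_mapRingHom, coe_evalRingHom]
      refine Finset.sum_congr rfl fun i _ => ?_
      congr 1
      rw [eval_map_algebraMap]
      exact aeval_algebraMap_apply_eq_algebraMap_eval t (M i j)
    have hcomm : Q.map (evalRingHom t) * (P.map (evalRingHom t))ᵀ =
        P.map (evalRingHom t) * (Q.map (evalRingHom t))ᵀ := by
      have := congrArg (fun M : Matrix (Fin n) (Fin n) ℝ[X] => M.map (evalRingHom t)) h.symm
      simpa only [Matrix.map_mul, Matrix.transpose_map] using this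
    obtain ⟨hA, hB⟩ := vecMul_eq_zero_of_add_I_smul _ _ hcomm (fun i => (x i).eval (t : ℂ)) (by
      ext j
      have := congrArg (eval (t : ℂ)) (congrFun hx j)
      rw [Matrix.vecMul_add, Matrix.vecMul_smul] at this
      simp only [Pi.add_apply, Pi.smul_apply, smul_eq_mul, eval_add, eval_mul, eval_C, ev] at this
      simpa using this)
    intro j
    exact ⟨by rw [ev, hA]; rfl, by rw [ev, hB]; rfl⟩
  have hinf : (Set.range fun t : ℝ => (t : ℂ)).Infinite :=
    Set.infinite_range_of_injective Complex.ofReal_injective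
  apply hx0
  refine eq_zero_of_vecMul_eq_zero P Q hrank x ?_ ?_
  · ext1 j
    refine Polynomial.eq_zero_of_infinite_isRoot _ (hinf.mono ?_)
    rintro _ ⟨t, rfl⟩
    exact (key t j).2
  · ext1 j
    refine Polynomial.eq_zero_of_infinite_isRoot _ (hinf.mono ?_)
    rintro _ ⟨t, rfl⟩
    exact (key t j).1

/-- Multilinear expansion of `det (Q + iP)` in the columns shows that exchanging suitable columns
of `Q` for columns of `-P` yields a nonsingular matrix. -/
lemma exists_det_swapRight_ne_zero (P Q : Matrix (Fin n) (Fin n) ℝ[X])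
    (hrank : normalRank (Matrix.fromCols P (-Q)) = n) (h : P * Qᵀ = Q * Pᵀ) :
    ∃ S : Finset (Fin n), (swapRight S P Q).det ≠ 0 := by
  by_contra! hall
  apply det_add_I_smul_ne_zero P Q hrank h
  set Q' := Q.map (mapRingHom (algebraMap ℝ ℂ))
  set P' := P.map (mapRingHom (algebraMap ℝ ℂ))
  rw [← Matrix.det_transpose, Matrix.transpose_add]
  have := (Matrix.detRowAlternating (n := Fin n) (R := ℂ[X])).toMultilinearMap.map_add_univ
    (fun j => Q'ᵀ j) (fun j => ((C Complex.I) • P')ᵀ j)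
  refine Eq.trans this (Finset.sum_eq_zero fun S _ => ?_)
  change Matrix.det (S.piecewise (fun j => Q'ᵀ j) (fun j => ((C Complex.I) • P')ᵀ j)) = 0
  have e : (Matrix.of (S.piecewise (fun j => Q'ᵀ j) (fun j => ((C Complex.I) • P')ᵀ j)))ᵀ =
      (swapRight S P Q).map (mapRingHom (algebraMap ℝ ℂ)) *
        Matrix.diagonal (fun j => if j ∈ S then 1 else -C Complex.I) := by
    ext1 k j
    rw [Matrix.mul_diagonal]
    by_cases hj : j ∈ S
    · simp [swapRight, hj, Q']
    · simp [swapRight, hj, P', mul_comm]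
  have e2 := congrArg Matrix.det e
  rw [Matrix.det_transpose, Matrix.det_mul, ← RingHom.mapMatrix_apply, ← RingHom.map_det, hall S,
    map_zero, zero_mul] at e2
  exact e2

end Nonsingular

/-! ### Proper transfer matrices -/

section Proper

variable {ι : Type*} [Fintype ι] [DecidableEq ι]

lemma isProper_div {a d : ℝ[X]} (hd : d ≠ 0) (h : a = 0 ∨ a.natDegree ≤ d.natDegree) :
    IsProper (algebraMap ℝ[X] (RatFunc ℝ) a / algebraMap ℝ[X] (RatFunc ℝ) d) := by
  set f := algebraMap ℝ[X] (RatFunc ℝ) a / algebraMap ℝ[X] (RatFunc ℝ) d with hf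
  have hd' : algebraMap ℝ[X] (RatFunc ℝ) d ≠ 0 := RatFunc.algebraMap_ne_zero hd
  have hden : algebraMap ℝ[X] (RatFunc ℝ) f.denom ≠ 0 :=
    RatFunc.algebraMap_ne_zero f.denom_ne_zero
  have key : f.num * d = a * f.denom := by
    apply RatFunc.algebraMap_injective ℝ
    rw [map_mul, map_mul]
    exact (div_eq_div_iff hden hd').mp ((RatFunc.num_div_denom f).trans hf)
  unfold IsProper
  rcases eq_or_ne a 0 with ha | ha
  · have : f = 0 := by rw [hf, ha]; simp
    rw [this]; simp
  · have hle := h.resolve_left ha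
    have hnum : f.num ≠ 0 := by
      rintro h0
      rw [h0, zero_mul] at key
      exact mul_ne_zero ha f.denom_ne_zero key.symm
    have := congrArg natDegree key
    rw [natDegree_mul hnum hd, natDegree_mul ha f.denom_ne_zero] at this
    rw [degree_eq_natDegree hnum, degree_eq_natDegree f.denom_ne_zero]
    exact_mod_cast (by omega : f.num.natDegree ≤ f.denom.natDegree)

lemma transferMatrix_eq_smul (P Q : Matrix ι ι ℝ[X]) :
    transferMatrix P Q = (algebraMap ℝ[X] (RatFunc ℝ) Q.det)⁻¹ •
      (Q.adjugate * P).map (algebraMap ℝ[X] (RatFunc ℝ)) := by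
  rw [transferMatrix, Matrix.inv_def, Ring.inverse_eq_inv', Matrix.smul_mul, Matrix.map_mul]
  simp only [← RingHom.mapMatrix_apply, ← RingHom.map_det, ← RingHom.map_adjugate]

lemma transferMatrix_isSymm_iff (P Q : Matrix ι ι ℝ[X]) (hQ : Q.det ≠ 0) :
    (transferMatrix P Q).IsSymm ↔ (Q.adjugate * P).IsSymm := by
  have hd : (algebraMap ℝ[X] (RatFunc ℝ) Q.det)⁻¹ ≠ 0 :=
    inv_ne_zero (RatFunc.algebraMap_ne_zero hQ)
  rw [transferMatrix_eq_smul, Matrix.IsSymm, Matrix.IsSymm, Matrix.transpose_smul]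
  rw [(smul_right_injective _ hd).eq_iff, ← Matrix.transpose_map,
    (Matrix.map_injective (RatFunc.algebraMap_injective ℝ)).eq_iff]

/-- Multiplied by `Q` on the left and by `Qᵀ` on the right, the symmetry of `adj(Q) P` becomes
`det Q` times the relation `P Qᵀ = Q Pᵀ`. -/
lemma adjugate_mul_isSymm (P Q : Matrix ι ι ℝ[X]) (hQ : Q.det ≠ 0) (h : P * Qᵀ = Q * Pᵀ) :
    (Q.adjugate * P).IsSymm := by
  have hcan : ∀ {A B : Matrix ι ι ℝ[X]}, Q * A = Q * B → A = B := fun {A B} hAB => by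
    have := congrArg (fun M => Q.adjugate * M) hAB
    simp only [← Matrix.mul_assoc, Matrix.adjugate_mul, Matrix.smul_mul, Matrix.one_mul] at this
    exact smul_right_injective _ hQ this
  apply hcan
  apply Matrix.transpose_injective
  apply hcan
  have e1 : Q * (Q.adjugate * P)ᵀᵀ * Qᵀ = Q.det • (P * Qᵀ) := by
    rw [Matrix.transpose_transpose, ← Matrix.mul_assoc, Matrix.mul_adjugate, Matrix.smul_mul,
      Matrix.one_mul, Matrix.smul_mul]
  have e2 : Q * (Q.adjugate * P)ᵀ * Qᵀ = Q.det • (Q * Pᵀ) := by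
    rw [Matrix.mul_assoc, ← Matrix.transpose_mul, ← Matrix.mul_assoc Q, Matrix.mul_adjugate,
      Matrix.smul_mul, Matrix.one_mul, Matrix.transpose_smul, Matrix.mul_smul]
  have e3 := e1.trans ((congrArg (Q.det • ·) h).trans e2.symm)
  simpa only [Matrix.transpose_mul, Matrix.transpose_transpose, Matrix.mul_assoc] using e3

/-- Cramer's rule: the diagonal entries of `adj(Q) P` are the determinants of `Q` with one column
replaced by that of `P`. -/
lemma adjugate_mul_diag (P Q : Matrix ι ι ℝ[X]) (i : ι) :
    (Q.adjugate * P) i i = (swapLeft {i} P Q).det := by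
  have e : swapLeft {i} P Q = Q.updateCol i (P.col i) := by
    ext k j
    by_cases hj : j = i
    · subst hj; simp [swapLeft]
    · simp [swapLeft, hj]
  rw [e, ← Matrix.cramer_apply, Matrix.cramer_eq_adjugate_mulVec]
  rfl

/-- The principal `2 × 2` minors of `adj(Q) P` are, up to the factor `det Q`, the determinants of
`Q` with two columns replaced by those of `P`. -/
lemma adjugate_mul_minor (P Q : Matrix ι ι ℝ[X]) (hQ : Q.det ≠ 0) {i j : ι} (hij : i ≠ j) :
    (Q.adjugate * P) i i * (Q.adjugate * P) j j - (Q.adjugate * P) i j * (Q.adjugate * P) j i =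
      Q.det * (swapLeft {i, j} P Q).det := by
  set a := Q.adjugate * P with ha
  set φ := algebraMap ℝ[X] (RatFunc ℝ) with hφ
  have hd : φ Q.det ≠ 0 := RatFunc.algebraMap_ne_zero hQ
  apply RatFunc.algebraMap_injective ℝ
  set H := transferMatrix P Q with hH
  have hHa : ∀ k l, φ (a k l) = φ Q.det * H k l := by
    intro k l
    rw [hH, transferMatrix_eq_smul, Matrix.smul_apply, smul_eq_mul, mul_inv_cancel_left₀ hd]
    rfl
  have hunit : IsUnit (Q.map φ).det := by
    rw [← RingHom.mapMatrix_apply, ← RingHom.map_det]; exact hd.isUnit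
  have hQH : Q.map φ * H = P.map φ := Matrix.mul_nonsing_inv_cancel_left _ _ hunit
  -- The swapped matrix is `Q (1 + U V)`, where `U` holds the changes of the two columns.
  let U : Matrix ι (Fin 2) (RatFunc ℝ) :=
    Matrix.of fun k c =>
      if c = 0 then H k i - (1 : Matrix ι ι _) k i else H k j - (1 : Matrix ι ι _) k j
  let V : Matrix (Fin 2) ι (RatFunc ℝ) :=
    Matrix.of fun c l => if c = 0 then (1 : Matrix ι ι _) i l else (1 : Matrix ι ι _) j l
  have hE : Matrix.map (swapLeft {i, j} P Q) φ = Q.map φ * (1 + U * V) := by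
    have : 1 + U * V = swapLeft {i, j} H (1 : Matrix ι ι (RatFunc ℝ)) := by
      ext k l
      by_cases hli : l = i
      · subst hli
        simp [swapLeft, U, V, Matrix.mul_apply, hij.symm, Matrix.one_apply]
      · by_cases hlj : l = j
        · subst hlj
          simp [swapLeft, U, V, Matrix.mul_apply, hij, Matrix.one_apply]
        · simp [swapLeft, U, V, Matrix.mul_apply, hli, hlj, Ne.symm hli,
            Ne.symm hlj, Matrix.one_apply]
    rw [this]
    ext k l
    by_cases hl : l ∈ ({i, j} : Finset ι)
    · have h1 : (Q.map φ * swapLeft {i, j} H 1) k l = (Q.map φ * H) k l := by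
        simp only [Matrix.mul_apply, swapLeft, Matrix.of_apply, if_pos hl]
      rw [h1, hQH]
      simp only [Matrix.map_apply, swapLeft, Matrix.of_apply, if_pos hl]
    · have h1 : (Q.map φ * swapLeft {i, j} H 1) k l = (Q.map φ) k l := by
        refine Eq.trans ?_ (congrFun (congrFun (Matrix.mul_one (Q.map φ)) k) l)
        simp only [Matrix.mul_apply, swapLeft, Matrix.of_apply, if_neg hl]
      rw [h1]
      simp only [Matrix.map_apply, swapLeft, Matrix.of_apply, if_neg hl]
  have hdet : φ (swapLeft {i, j} P Q).det = φ Q.det * (H i i * H j j - H i j * H j i) := by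
    rw [RingHom.map_det, RingHom.mapMatrix_apply, hE, Matrix.det_mul, Matrix.det_one_add_mul_comm,
      Matrix.det_fin_two, RingHom.map_det, RingHom.mapMatrix_apply]
    simp [U, V, Matrix.mul_apply, Matrix.one_apply, hij, hij.symm]
  rw [map_sub, map_mul, map_mul, map_mul, hdet, hHa, hHa, hHa, hHa]
  ring

/-- If `det Q` has maximal degree among the matrices obtained from `Q` by replacing columns by
the corresponding columns of `P`, and `adj(Q) P` is symmetric, then `Q⁻¹ P` is proper:
its principal minors of order at most two are, and these determine the squares of its entries. -/
lemma isProper_transferMatrix (P Q : Matrix ι ι ℝ[X]) (hQ : Q.det ≠ 0)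
    (hsymm : (Q.adjugate * P).IsSymm)
    (hmax : ∀ T : Finset ι, (swapLeft T P Q).det.natDegree ≤ Q.det.natDegree) (i j : ι) :
    IsProper (transferMatrix P Q i j) := by
  have e : transferMatrix P Q i j = algebraMap ℝ[X] (RatFunc ℝ) ((Q.adjugate * P) i j) /
      algebraMap ℝ[X] (RatFunc ℝ) Q.det := by
    rw [transferMatrix_eq_smul, Matrix.smul_apply, smul_eq_mul, div_eq_inv_mul]
    rfl
  rw [e]
  refine isProper_div hQ (Or.inr ?_)
  have hdiag : ∀ k, ((Q.adjugate * P) k k).natDegree ≤ Q.det.natDegree := fun k => by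
    rw [adjugate_mul_diag]; exact hmax _
  by_cases hij : i = j
  · subst hij; exact hdiag i
  have hminor := adjugate_mul_minor P Q hQ hij
  rw [hsymm.apply i j] at hminor
  have hsq : (Q.adjugate * P) i j ^ 2 = (Q.adjugate * P) i i * (Q.adjugate * P) j j -
      Q.det * (swapLeft {i, j} P Q).det := by
    rw [← hminor]; ring
  have h2 := congrArg natDegree hsq
  rw [natDegree_pow] at h2
  have h3 := natDegree_sub_le ((Q.adjugate * P) i i * (Q.adjugate * P) j j)
    (Q.det * (swapLeft {i, j} P Q).det)
  have h4 := natDegree_mul_le (p := (Q.adjugate * P) i i) (q := (Q.adjugate * P) j j)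
  have h5 := natDegree_mul_le (p := Q.det) (q := (swapLeft {i, j} P Q).det)
  have := hdiag i
  have := hdiag j
  have := hmax {i, j}
  omega

end Proper

/-- Among all exchanges that make the right-hand side matrix nonsingular, one with a determinant of
maximal degree gives a proper symmetric transfer matrix. -/
lemma exists_swap_isProper {n : ℕ} (P Q : Matrix (Fin n) (Fin n) ℝ[X])
    (hrank : normalRank (Matrix.fromCols P (-Q)) = n) (h : P * Qᵀ = Q * Pᵀ) :
    ∃ S : Finset (Fin n), (swapRight S P Q).det ≠ 0 ∧
      (∀ i j, IsProper (transferMatrix (swapLeft S P Q) (swapRight S P Q) i j)) ∧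
      (transferMatrix (swapLeft S P Q) (swapRight S P Q)).IsSymm := by
  classical
  obtain ⟨S₀, hS₀⟩ := exists_det_swapRight_ne_zero P Q hrank h
  obtain ⟨S, hS, hmax⟩ := Finset.exists_max_image
    (Finset.univ.filter fun S => (swapRight S P Q).det ≠ 0)
    (fun S => (swapRight S P Q).det.natDegree) ⟨S₀, by simpa using hS₀⟩
  have hS' : (swapRight S P Q).det ≠ 0 := by simpa using hS
  have hsymm := adjugate_mul_isSymm _ _ hS' (swap_mul_transpose S P Q h)
  refine ⟨S, hS', ?_, (transferMatrix_isSymm_iff _ _ hS').mpr hsymm⟩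
  refine isProper_transferMatrix _ _ hS' hsymm fun T => ?_
  rw [← natDegree_det_swapRight_symmDiff]
  by_cases h0 : (swapRight (symmDiff S T) P Q).det = 0
  · rw [h0]; simp
  · exact hmax _ (by simpa using h0)

/-! ### The module `𝓓₊` over the differential operators -/

section DPlus

/-- The space `𝓓₊` of scalar smooth functions with support bounded on the left. -/
def dPlus : Submodule ℝ (ℝ → ℝ) where
  carrier := {f | ContDiff ℝ ∞ f ∧ BddBelow (Function.support f)}
  add_mem' := fun {f g} hf hg =>
    ⟨hf.1.add hg.1, (hf.2.union hg.2).mono (Function.support_add f g)⟩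
  zero_mem' := ⟨contDiff_const, by simp⟩
  smul_mem' := fun c f hf => ⟨hf.1.const_smul c, hf.2.mono (Function.support_const_smul_subset c f)⟩

lemma bddBelow_support_iff {f : ℝ → ℝ} :
    BddBelow (Function.support f) ↔ ∃ L, ∀ t < L, f t = 0 := by
  constructor
  · rintro ⟨L, hL⟩
    exact ⟨L, fun t ht => by_contra fun h => absurd (hL h) (not_le.mpr ht)⟩
  · rintro ⟨L, hL⟩
    exact ⟨L, fun t ht => not_lt.mp fun h => ht (hL t h)⟩

lemma mem_dPlus_iff {f : ℝ → ℝ} : f ∈ dPlus ↔ ContDiff ℝ ∞ f ∧ ∃ L, ∀ t < L, f t = 0 :=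
  and_congr_right fun _ => bddBelow_support_iff

lemma contDiff_coe (f : dPlus) : ContDiff ℝ ∞ (f : ℝ → ℝ) := f.2.1

lemma exists_eq_zero_of_lt (f : dPlus) : ∃ L, ∀ t < L, (f : ℝ → ℝ) t = 0 :=
  (mem_dPlus_iff.mp f.2).2

lemma deriv_eq_zero_of_lt {f : ℝ → ℝ} {L : ℝ} (hL : ∀ t < L, f t = 0) {t : ℝ} (ht : t < L) :
    deriv f t = 0 := by
  have : f =ᶠ[nhds t] fun _ => 0 := by
    filter_upwards [Iio_mem_nhds ht] with s hs using hL s hs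
  rw [this.deriv_eq, deriv_const]

/-- Differentiation on `𝓓₊`. -/
noncomputable def dPlusDeriv : Module.End ℝ dPlus where
  toFun f := ⟨deriv f, mem_dPlus_iff.mpr ⟨(contDiff_infty_iff_deriv.mp (contDiff_coe f)).2, by
    obtain ⟨L, hL⟩ := exists_eq_zero_of_lt f
    exact ⟨L, fun t ht => deriv_eq_zero_of_lt hL ht⟩⟩⟩
  map_add' f g := by
    ext t
    exact deriv_add ((contDiff_coe f).differentiable (by simp) t)
      ((contDiff_coe g).differentiable (by simp) t)
  map_smul' c f := by
    ext t
    exact deriv_const_smul c ((contDiff_coe f).differentiable (by simp) t)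

/-- The `ℝ[X]`-module structure on `𝓓₊` in which `X` acts as differentiation, so that `p • f` is
`p(d/dt) f`. -/
noncomputable instance : Module ℝ[X] dPlus :=
  Module.compHom dPlus (aeval dPlusDeriv : ℝ[X] →ₐ[ℝ] Module.End ℝ dPlus).toRingHom

lemma poly_smul_def (p : ℝ[X]) (f : dPlus) : p • f = aeval dPlusDeriv p f := rfl

lemma coe_dPlusDeriv_pow (k : ℕ) (f : dPlus) :
    (((dPlusDeriv ^ k) f : dPlus) : ℝ → ℝ) = iteratedDeriv k f := by
  induction k with
  | zero => simp
  | succ k ih =>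
    rw [iteratedDeriv_succ, ← ih, pow_succ', Module.End.mul_apply]
    rfl

lemma poly_smul_apply (p : ℝ[X]) (f : dPlus) (t : ℝ) :
    ((p • f : dPlus) : ℝ → ℝ) t = p.sum fun k a => a * iteratedDeriv k f t := by
  rw [poly_smul_def, aeval_endomorphism, Polynomial.sum, Polynomial.sum, Submodule.coe_sum,
    Finset.sum_apply]
  refine Finset.sum_congr rfl fun k _ => ?_
  rw [← coe_dPlusDeriv_pow]
  rfl

lemma iteratedDeriv_eq_zero_of_lt {f : ℝ → ℝ} {L : ℝ} (hL : ∀ t < L, f t = 0) (k : ℕ) {t : ℝ}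
    (ht : t < L) : iteratedDeriv k f t = 0 := by
  induction k generalizing t with
  | zero => simpa using hL t ht
  | succ k ih =>
    rw [iteratedDeriv_succ]
    exact deriv_eq_zero_of_lt (fun s hs => ih hs) ht

/-- `𝓓₊` is a torsion-free `ℝ[X]`-module: a solution of `p(d/dt) f = 0` that vanishes far to the
left is zero, by Grönwall's inequality for the vector of its derivatives. -/
lemma eq_zero_of_poly_smul_eq_zero {p : ℝ[X]} (hp : p ≠ 0) {f : dPlus} (h : p • f = 0) : f = 0 := by
  obtain ⟨L, hL⟩ := exists_eq_zero_of_lt f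
  -- Passing to `X * p` makes the order of the equation positive.
  set q := X * p with hq
  have hq0 : q ≠ 0 := mul_ne_zero X_ne_zero hp
  have hqf : q • f = 0 := by rw [hq, mul_smul, h, smul_zero]
  have hm : 0 < q.natDegree := by rw [hq, natDegree_X_mul hp]; omega
  set m := q.natDegree with hmdef
  have hlead : q.coeff m ≠ 0 := by rw [hmdef, coeff_natDegree]; exact leadingCoeff_ne_zero.mpr hq0
  set K : ℝ := 1 + ∑ k : Fin m, |q.coeff k / q.coeff m| with hK
  have hK1 : 1 ≤ K := le_add_of_nonneg_right (Finset.sum_nonneg fun _ _ => abs_nonneg _)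
  let x : ℝ → Fin m → ℝ := fun t k => iteratedDeriv k f t
  let x' : ℝ → Fin m → ℝ := fun t k => iteratedDeriv (k + 1) f t
  have hx : ∀ t, HasDerivAt x (x' t) t := fun t => by
    rw [hasDerivAt_pi]
    intro k
    have : Differentiable ℝ (iteratedDeriv k (f : ℝ → ℝ)) :=
      (contDiff_coe f).differentiable_iteratedDeriv k (by exact_mod_cast ENat.natCast_lt_top _)
    simpa [x, x', iteratedDeriv_succ] using (this t).hasDerivAt
  have hlast : ∀ t, iteratedDeriv m f t = -∑ k : Fin m, q.coeff k / q.coeff m * x t k := fun t => by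
    have h1 := poly_smul_apply q f t
    rw [hqf, Polynomial.sum_over_range _ (fun k => by simp), Finset.sum_range_succ,
      Finset.sum_range] at h1
    have h2 : ∑ k : Fin m, q.coeff k / q.coeff m * x t k =
        (∑ k : Fin m, q.coeff k * iteratedDeriv k f t) / q.coeff m := by
      rw [Finset.sum_div]
      exact Finset.sum_congr rfl fun k _ => div_mul_eq_mul_div _ _ _
    rw [h2, ← neg_div, eq_div_iff hlead]
    have h3 : ((0 : dPlus) : ℝ → ℝ) t = 0 := rfl
    rw [h3] at h1
    linarith
  have hbound : ∀ t, ‖x' t‖ ≤ K * ‖x t‖ := fun t => by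
    rw [pi_norm_le_iff_of_nonneg (by positivity)]
    intro k
    by_cases hk : (k : ℕ) + 1 < m
    · calc ‖x' t k‖ = ‖x t ⟨k + 1, hk⟩‖ := rfl
        _ ≤ 1 * ‖x t‖ := by rw [one_mul]; exact norm_le_pi_norm _ _
        _ ≤ K * ‖x t‖ := by gcongr
    · have hkm : (k : ℕ) + 1 = m := by have := k.2; omega
      have e : x' t k = -∑ k : Fin m, q.coeff k / q.coeff m * x t k := by
        rw [← hlast]; simp only [x', hkm]
      rw [e, norm_neg]
      calc ‖∑ k : Fin m, q.coeff k / q.coeff m * x t k‖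
          ≤ ∑ k : Fin m, |q.coeff k / q.coeff m| * ‖x t‖ := by
            refine (norm_sum_le _ _).trans (Finset.sum_le_sum fun k _ => ?_)
            rw [norm_mul, Real.norm_eq_abs]
            gcongr
            exact norm_le_pi_norm _ _
        _ = (∑ k : Fin m, |q.coeff k / q.coeff m|) * ‖x t‖ := by rw [Finset.sum_mul]
        _ ≤ K * ‖x t‖ := by gcongr; rw [hK]; linarith
  ext t
  change (f : ℝ → ℝ) t = 0
  by_cases ht : t < L
  · exact hL t ht
  have hxt := eq_zero_of_abs_deriv_le_mul_abs_self_of_eq_zero_right (f := x) (f' := x') (K := K)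
    (a := L - 1) (b := t) (fun s _ => (hx s).continuousAt.continuousWithinAt)
    (fun s _ => (hx s).hasDerivWithinAt)
    (by ext k; exact iteratedDeriv_eq_zero_of_lt hL k (by linarith)) (fun s _ => hbound s) t
    ⟨by linarith [not_lt.mp ht], le_rfl⟩
  simpa [x] using congrFun hxt ⟨0, hm⟩

end DPlus

/-! ### Convolution on `𝓓₊` -/

section Convolution

/-- The convolution of two scalar functions. -/
noncomputable def scalarConv (f g : ℝ → ℝ) (t : ℝ) : ℝ := ∫ τ, f τ * g (t - τ)

lemma scalarConv_eq_convolution (f g : ℝ → ℝ) :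
    scalarConv f g = convolution f g (ContinuousLinearMap.mul ℝ ℝ) volume := rfl

lemma scalarConv_comm (f g : ℝ → ℝ) : scalarConv f g = scalarConv g f := by
  ext t
  rw [scalarConv_eq_convolution, convolution_mul_swap]
  simp only [scalarConv, mul_comm]

lemma integrable_conv (f g : dPlus) (t : ℝ) :
    Integrable fun τ => (f : ℝ → ℝ) τ * (g : ℝ → ℝ) (t - τ) := by
  obtain ⟨L, hL⟩ := exists_eq_zero_of_lt f
  obtain ⟨M, hM⟩ := exists_eq_zero_of_lt g
  have hf := (contDiff_coe f).continuous
  have hg := (contDiff_coe g).continuous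
  refine Continuous.integrable_of_hasCompactSupport (by fun_prop) ?_
  refine HasCompactSupport.of_support_subset_isCompact (isCompact_Icc (a := L) (b := t - M)) ?_
  intro τ hτ
  rw [Function.mem_support] at hτ
  refine ⟨not_lt.mp fun h => hτ ?_, not_lt.mp fun h => hτ ?_⟩
  · rw [hL τ h, zero_mul]
  · rw [hM (t - τ) (by linarith), mul_zero]

/-- Up to a given time, the convolution with a function in `𝓓₊` coincides with the convolution with
a compactly supported truncation of it, and likewise for the derivative. -/
lemma exists_truncation (f g : dPlus) (t₀ : ℝ) : ∃ g' : ℝ → ℝ, ContDiff ℝ ∞ g' ∧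
    HasCompactSupport g' ∧ (∀ t < t₀, scalarConv f g t = scalarConv f g' t) ∧
    ∀ t < t₀, scalarConv f (deriv g) t = scalarConv f (deriv g') t := by
  obtain ⟨L, hL⟩ := exists_eq_zero_of_lt f
  obtain ⟨M, hM⟩ := exists_eq_zero_of_lt g
  let g' : ℝ → ℝ := fun s => Real.smoothTransition (t₀ - L + 1 - s) * (g : ℝ → ℝ) s
  have heq : ∀ s < t₀ - L, (g : ℝ → ℝ) s = g' s := fun s hs => by
    simp only [g']
    rw [Real.smoothTransition.one_of_one_le (by linarith), one_mul]
  have heq' : ∀ s < t₀ - L, deriv (g : ℝ → ℝ) s = deriv g' s := fun s hs => by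
    refine Filter.EventuallyEq.deriv_eq ?_
    filter_upwards [Iio_mem_nhds hs] with r hr using heq r hr
  have hconv : ∀ u v : ℝ → ℝ, (∀ s < t₀ - L, u s = v s) → ∀ t < t₀,
      scalarConv f u t = scalarConv f v t := fun u v huv t ht => by
    refine integral_congr_ae (Filter.Eventually.of_forall fun τ => ?_)
    by_cases hτ : τ < L
    · simp only [hL τ hτ, zero_mul]
    · simp only [huv (t - τ) (by linarith [not_lt.mp hτ])]
  refine ⟨g', ?_, ?_, hconv _ _ heq, hconv _ _ heq'⟩
  · exact (Real.smoothTransition.contDiff.comp (contDiff_const.sub contDiff_id)).mul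
      (contDiff_coe g)
  · refine HasCompactSupport.of_support_subset_isCompact
      (isCompact_Icc (a := M) (b := t₀ - L + 1)) ?_
    intro s hs
    rw [Function.mem_support] at hs
    refine ⟨not_lt.mp fun h => hs ?_, not_lt.mp fun h => hs ?_⟩
    · simp only [g', hM s h, mul_zero]
    · simp only [g']
      rw [Real.smoothTransition.zero_of_nonpos (by linarith), zero_mul]

lemma contDiff_scalarConv (f g : dPlus) : ContDiff ℝ ∞ (scalarConv f g) := by
  rw [contDiff_iff_contDiffAt]
  intro t
  obtain ⟨g', hg', hc, h1, -⟩ := exists_truncation f g (t + 1)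
  have h2 : ContDiff ℝ ∞ (scalarConv f g') :=
    hc.contDiff_convolution_right (ContinuousLinearMap.mul ℝ ℝ)
      (contDiff_coe f).continuous.locallyIntegrable hg'
  refine h2.contDiffAt.congr_of_eventuallyEq ?_
  filter_upwards [Iio_mem_nhds (lt_add_one t)] with s hs using h1 s hs

lemma deriv_scalarConv (f g : dPlus) : deriv (scalarConv f g) = scalarConv f (deriv g) := by
  ext t
  obtain ⟨g', hg', hc, h1, h2⟩ := exists_truncation f g (t + 1)
  have h3 : HasDerivAt (scalarConv f g') (scalarConv f (deriv g') t) t :=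
    hc.hasDerivAt_convolution_right (ContinuousLinearMap.mul ℝ ℝ)
      (contDiff_coe f).continuous.locallyIntegrable (hg'.of_le (by simp)) t
  rw [h2 t (lt_add_one t)]
  refine (h3.congr_of_eventuallyEq ?_).deriv
  filter_upwards [Iio_mem_nhds (lt_add_one t)] with s hs using h1 s hs

lemma scalarConv_mem_dPlus (f g : dPlus) : scalarConv f g ∈ dPlus := by
  refine mem_dPlus_iff.mpr ⟨contDiff_scalarConv f g, ?_⟩
  obtain ⟨L, hL⟩ := exists_eq_zero_of_lt f
  obtain ⟨M, hM⟩ := exists_eq_zero_of_lt g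
  refine ⟨L + M, fun t ht => ?_⟩
  refine integral_eq_zero_of_ae (Filter.Eventually.of_forall fun τ => ?_)
  by_cases hτ : τ < L
  · simp [hL τ hτ]
  · simp [hM (t - τ) (by linarith [not_lt.mp hτ])]

/-- The convolution on `𝓓₊` as a map that is `ℝ`-linear in the second argument. -/
noncomputable def dPlusConvAux (f : dPlus) : dPlus →ₗ[ℝ] dPlus where
  toFun g := ⟨scalarConv f g, scalarConv_mem_dPlus f g⟩
  map_add' g h := by
    ext t
    change scalarConv f (g + h : dPlus) t = scalarConv f g t + scalarConv f h t
    rw [scalarConv, scalarConv, scalarConv, ← integral_add (integrable_conv f g t)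
      (integrable_conv f h t)]
    exact integral_congr_ae (Filter.Eventually.of_forall fun τ => mul_add _ _ _)
  map_smul' c g := by
    ext t
    change scalarConv f (c • g : dPlus) t = c * scalarConv f g t
    rw [scalarConv, scalarConv, ← integral_const_mul]
    exact integral_congr_ae (Filter.Eventually.of_forall fun τ => mul_left_comm _ _ _)

lemma dPlusConvAux_comm (f g : dPlus) : dPlusConvAux f g = dPlusConvAux g f :=
  Subtype.ext (scalarConv_comm f g)

lemma dPlusConvAux_poly_smul (f : dPlus) (p : ℝ[X]) (g : dPlus) :
    dPlusConvAux f (p • g) = p • dPlusConvAux f g := by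
  have hD : Commute (dPlusConvAux f) dPlusDeriv := by
    ext1 g
    exact Subtype.ext (deriv_scalarConv f g).symm
  have : Commute (dPlusConvAux f) (aeval dPlusDeriv p) := by
    induction p using Polynomial.induction_on' with
    | add p q hp hq => rw [map_add]; exact hp.add_right hq
    | monomial k a =>
      rw [aeval_monomial]
      exact (Algebra.commute_algebraMap_right a _).mul_right (hD.pow_right k)
  exact LinearMap.congr_fun this g

/-- Convolution on `𝓓₊` as an `ℝ[X]`-bilinear map. Here no sign arises when a differential operator
moves from one factor to the other. -/
noncomputable def dPlusConv : dPlus →ₗ[ℝ[X]] dPlus →ₗ[ℝ[X]] dPlus :=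
  LinearMap.mk₂ ℝ[X] (fun f g => dPlusConvAux f g)
    (fun f f' g => by
      rw [dPlusConvAux_comm, map_add, dPlusConvAux_comm f, dPlusConvAux_comm f'])
    (fun p f g => by
      rw [dPlusConvAux_comm, dPlusConvAux_poly_smul, dPlusConvAux_comm])
    (fun f g g' => map_add _ _ _)
    (fun p f g => dPlusConvAux_poly_smul f p g)

lemma dPlusConv_apply (f g : dPlus) (t : ℝ) :
    (dPlusConv f g : ℝ → ℝ) t = ∫ τ, (f : ℝ → ℝ) τ * (g : ℝ → ℝ) (t - τ) := rfl

/-- The fundamental lemma of the calculus of variations, for functions in `𝓓₊`. -/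
lemma eq_zero_of_forall_integral_eq_zero (f : dPlus)
    (h : ∀ φ, IsTestFunction φ → ∫ t, (f : ℝ → ℝ) t * φ t = 0) : f = 0 := by
  have hc := (contDiff_coe f).continuous
  have := ae_eq_zero_of_integral_contDiff_smul_eq_zero (μ := volume) hc.locallyIntegrable
    (fun φ h1 h2 => by
      rw [← h φ ⟨h1, h2⟩]
      exact integral_congr_ae (Filter.Eventually.of_forall fun t => mul_comm _ _))
  exact Subtype.ext (Continuous.ae_eq_iff_eq volume hc continuous_const |>.mp this)

/-- The reflection of a test function, as an element of `𝓓₊`. -/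
def IsTestFunction.reflect {φ : ℝ → ℝ} (hφ : IsTestFunction φ) : dPlus :=
  ⟨fun t => φ (-t), hφ.1.comp contDiff_neg, by
    have hc : HasCompactSupport fun t => φ (-t) := hφ.2.comp_homeomorph (Homeomorph.neg ℝ)
    exact hc.isCompact.bddBelow.mono (subset_tsupport _)⟩

lemma adjointOp_eq_poly_smul_reflect {φ : ℝ → ℝ} (hφ : IsTestFunction φ) (p : ℝ[X]) (t : ℝ) :
    adjointOp p φ t = ((p • hφ.reflect : dPlus) : ℝ → ℝ) (-t) := by
  rw [poly_smul_apply, adjointOp]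
  refine Finset.sum_congr rfl fun k _ => ?_
  have : iteratedDeriv k (hφ.reflect : ℝ → ℝ) (-t) = (-1 : ℝ) ^ k • iteratedDeriv k φ (- -t) :=
    iteratedDeriv_comp_neg k φ (-t)
  simp only [this, neg_neg, smul_eq_mul, mul_assoc]

lemma eq_zero_of_forall_dPlusConv_eq_zero (f : dPlus) (h : ∀ g, dPlusConv f g = 0) : f = 0 := by
  refine eq_zero_of_forall_integral_eq_zero f fun φ hφ => ?_
  have h1 := dPlusConv_apply f hφ.reflect 0
  rw [h] at h1
  simpa [IsTestFunction.reflect] using h1.symm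

lemma exists_dPlus_ne_zero : ∃ f : dPlus, f ≠ 0 := by
  refine ⟨⟨Real.smoothTransition, mem_dPlus_iff.mpr ⟨Real.smoothTransition.contDiff, 0,
    fun t ht => Real.smoothTransition.zero_of_nonpos ht.le⟩⟩, fun h => ?_⟩
  have := congrFun (congrArg Subtype.val h) 1
  simp [Real.smoothTransition.one] at this

end Convolution

/-! ### Trajectories in `𝓓₊` -/

section Trajectories

variable {ι : Type*} [Fintype ι]

lemma locallyIntegrable_pi_iff {f : ℝ → ι → ℝ} :
    LocallyIntegrable f ↔ ∀ j, LocallyIntegrable fun t => f t j := by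
  simp only [locallyIntegrable_iff, IntegrableOn, integrable_pi_iff]
  exact ⟨fun h j k hk => h k hk j, fun h k hk j => h j k hk⟩

/-- The vector-valued function with the given components in `𝓓₊`. -/
def trajectory {ι : Type*} (w : ι → dPlus) : ℝ → ι → ℝ := fun t j => (w j : ℝ → ℝ) t

lemma isDPlus_trajectory (w : ι → dPlus) : IsDPlus (trajectory w) := by
  refine ⟨contDiff_pi.mpr fun j => contDiff_coe (w j), ?_⟩
  refine (Set.finite_univ.bddBelow_biUnion (I := (Set.univ : Set ι))
    (S := fun j => Function.support (w j : ℝ → ℝ)) |>.mpr fun j _ => (w j).2.2).mono ?_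
  intro t ht
  obtain ⟨j, hj⟩ := Function.ne_iff.mp ht
  exact Set.mem_biUnion (Set.mem_univ j) hj

lemma IsDPlus.exists_eq_trajectory {w : ℝ → ι → ℝ} (hw : IsDPlus w) :
    ∃ w' : ι → dPlus, w = trajectory w' := by
  have hsupp : ∀ j, (Function.support fun t => w t j) ⊆ Function.support w :=
    fun j t ht h => ht (congrFun h j)
  exact ⟨fun j => ⟨fun t => w t j, contDiff_pi.mp hw.1 j, hw.2.mono (hsupp j)⟩, rfl⟩

lemma conv_trajectory (w w' : ι → dPlus) (t : ℝ) :
    conv (trajectory w) (trajectory w') t =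
      ((∑ j, dPlusConv (w j) (w' j) : dPlus) : ℝ → ℝ) t := by
  rw [Submodule.coe_sum, Finset.sum_apply]
  simp only [dPlusConv_apply]
  rw [← integral_finsetSum _ fun j _ => integrable_conv (w j) (w' j) t]
  rfl

lemma isReciprocal_iff {B : Set ((ℝ → ι → ℝ) × (ℝ → ι → ℝ))} :
    IsReciprocal B ↔ ∀ iₐ vₐ i_b v_b : ι → dPlus, (trajectory iₐ, trajectory vₐ) ∈ B →
      (trajectory i_b, trajectory v_b) ∈ B →
      ∑ j, dPlusConv (v_b j) (iₐ j) = ∑ j, dPlusConv (i_b j) (vₐ j) := by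
  constructor
  · intro h iₐ vₐ i_b v_b ha hb
    have := h _ _ _ _ ha (isDPlus_trajectory _) (isDPlus_trajectory _) hb (isDPlus_trajectory _)
      (isDPlus_trajectory _)
    ext t
    have ht := congrFun this t
    rwa [conv_trajectory, conv_trajectory] at ht
  · intro h iₐ vₐ i_b v_b ha hia hva hb hib hvb
    obtain ⟨iₐ, rfl⟩ := hia.exists_eq_trajectory
    obtain ⟨vₐ, rfl⟩ := hva.exists_eq_trajectory
    obtain ⟨i_b, rfl⟩ := hib.exists_eq_trajectory
    obtain ⟨v_b, rfl⟩ := hvb.exists_eq_trajectory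
    ext t
    rw [conv_trajectory, conv_trajectory, h _ _ _ _ ha hb]

lemma distApply_trajectory {κ : Type*} (R : Matrix κ ι ℝ[X]) (w : ι → dPlus) {φ : ℝ → ℝ}
    (hφ : IsTestFunction φ) (k : κ) :
    distApply R (trajectory w) φ k = ∫ t, ((∑ j, R k j • w j : dPlus) : ℝ → ℝ) t * φ t := by
  have h1 : distApply R (trajectory w) φ k =
      ((∑ j, dPlusConv (w j) (R k j • hφ.reflect) : dPlus) : ℝ → ℝ) 0 := by
    rw [Submodule.coe_sum, Finset.sum_apply]
    refine Finset.sum_congr rfl fun j _ => ?_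
    rw [dPlusConv_apply]
    simp only [adjointOp_eq_poly_smul_reflect hφ, zero_sub]
    rfl
  have h2 : ∑ j, dPlusConv (w j) (R k j • hφ.reflect) =
      dPlusConv (∑ j, R k j • w j) hφ.reflect := by
    simp only [map_sum, LinearMap.sum_apply, map_smul, LinearMap.smul_apply]
  rw [h1, h2, dPlusConv_apply]
  simp [IsTestFunction.reflect]

/-- For trajectories in `𝓓₊`, the weak equation is an equation in the `ℝ[X]`-module `𝓓₊`. -/
lemma trajectory_mem_behavior_iff {κ : Type*} (P Q : Matrix κ ι ℝ[X]) (i v : ι → dPlus) :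
    (trajectory i, trajectory v) ∈ behavior P Q ↔
      ∀ k, ∑ j, P k j • i j = ∑ j, Q k j • v j := by
  constructor
  · rintro ⟨-, -, h⟩ k
    rw [← sub_eq_zero]
    refine eq_zero_of_forall_integral_eq_zero _ fun φ hφ => ?_
    have h1 := congrFun (h φ hφ) k
    rw [distApply_trajectory P i hφ, distApply_trajectory Q v hφ, ← sub_eq_zero,
      ← integral_sub] at h1
    · rw [← h1]
      exact integral_congr_ae (Filter.Eventually.of_forall fun t => sub_mul _ _ _)
    all_goals
      exact Continuous.integrable_of_hasCompactSupport
        ((contDiff_coe _).continuous.mul hφ.1.continuous) hφ.2.mul_left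
  · intro h
    refine ⟨(isDPlus_trajectory i).1.continuous.locallyIntegrable,
      (isDPlus_trajectory v).1.continuous.locallyIntegrable, fun φ hφ => ?_⟩
    ext k
    rw [distApply_trajectory P i hφ, distApply_trajectory Q v hφ, h k]

end Trajectories

/-! ### Reciprocity and symmetry -/

section Reciprocity

variable {ι : Type*} [Fintype ι]

/-- Reciprocity, tested on the trajectories `(M f, L f)` with `f ∈ 𝓓₊` that polynomial vectors in
the kernel of `[P  -Q]` generate, makes this kernel isotropic. -/
lemma IsReciprocal.dotProduct_eq {P Q : Matrix ι ι ℝ[X]} (h : IsReciprocal (behavior P Q))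
    {M L M' L' : ι → ℝ[X]} (hML : P *ᵥ M = Q *ᵥ L) (hML' : P *ᵥ M' = Q *ᵥ L') :
    L' ⬝ᵥ M = M' ⬝ᵥ L := by
  have hmem : ∀ {M L : ι → ℝ[X]} (_ : P *ᵥ M = Q *ᵥ L) (f : dPlus),
      (trajectory (fun j => M j • f), trajectory (fun j => L j • f)) ∈ behavior P Q := by
    intro M L hML f
    rw [trajectory_mem_behavior_iff]
    intro k
    simp only [smul_smul, ← Finset.sum_smul]
    exact congrArg (· • f) (congrFun hML k)
  have key : ∀ f g : dPlus, (L' ⬝ᵥ M - M' ⬝ᵥ L) • dPlusConv g f = 0 := by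
    intro f g
    have h1 := isReciprocal_iff.mp h _ _ _ _ (hmem hML f) (hmem hML' g)
    simp only [map_smul, LinearMap.smul_apply, smul_smul, ← Finset.sum_smul] at h1
    rw [sub_smul, sub_eq_zero, dotProduct_comm, dotProduct_comm M']
    exact h1
  by_contra hne
  obtain ⟨f, hf⟩ := exists_dPlus_ne_zero
  exact hf (eq_zero_of_forall_dPlusConv_eq_zero f fun g =>
    eq_zero_of_poly_smul_eq_zero (sub_ne_zero.mpr hne) (key g f))

lemma exists_clear_denominators (i v : ι → RatFunc ℝ) :
    ∃ d : RatFunc ℝ, d ≠ 0 ∧ ∃ M L : ι → ℝ[X],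
      algebraMap ℝ[X] (RatFunc ℝ) ∘ M = d • i ∧ algebraMap ℝ[X] (RatFunc ℝ) ∘ L = d • v := by
  obtain ⟨b, hb⟩ := IsLocalization.exist_integer_multiples_of_finite (nonZeroDivisors ℝ[X])
    (Sum.elim i v)
  choose w hw using hb
  refine ⟨algebraMap ℝ[X] (RatFunc ℝ) b,
    RatFunc.algebraMap_ne_zero (nonZeroDivisors.ne_zero b.2), w ∘ Sum.inl, w ∘ Sum.inr, ?_, ?_⟩
  · ext j
    exact (hw (Sum.inl j)).trans (Algebra.smul_def _ _)
  · ext j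
    exact (hw (Sum.inr j)).trans (Algebra.smul_def _ _)

lemma IsReciprocal.mul_transpose_comm {P Q : Matrix ι ι ℝ[X]}
    (h : IsReciprocal (behavior P Q)) : P * Qᵀ = Q * Pᵀ := by
  set φ := algebraMap ℝ[X] (RatFunc ℝ) with hφ
  have hinj : Function.Injective φ := RatFunc.algebraMap_injective ℝ
  have hker : ∀ {d : RatFunc ℝ} {i v : ι → RatFunc ℝ} {M L : ι → ℝ[X]}, φ ∘ M = d • i →
      φ ∘ L = d • v → P.map φ *ᵥ i = Q.map φ *ᵥ v → P *ᵥ M = Q *ᵥ L := by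
    intro d i v M L hM hL hiv
    ext1 k
    apply hinj
    rw [RingHom.map_mulVec, RingHom.map_mulVec, hM, hL, Matrix.mulVec_smul, Matrix.mulVec_smul,
      hiv]
  have := mul_transpose_comm_of_isotropic (P.map φ) (Q.map φ) (by
    intro i v i' v' hiv hiv'
    obtain ⟨d, hd, M, L, hM, hL⟩ := exists_clear_denominators i v
    obtain ⟨d', hd', M', L', hM', hL'⟩ := exists_clear_denominators i' v'
    have h1 := congrArg φ (h.dotProduct_eq (hker hM hL hiv) (hker hM' hL' hiv'))
    rw [RingHom.map_dotProduct, RingHom.map_dotProduct, hM, hL, hM', hL', smul_dotProduct,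
      dotProduct_smul, smul_dotProduct, dotProduct_smul] at h1
    exact smul_right_injective _ hd (smul_right_injective _ hd' h1))
  apply Matrix.map_injective hinj
  simpa only [Matrix.map_mul, Matrix.transpose_map] using this

/-- If `det Q • v = S i` with the symmetric polynomial matrix `S = adj(Q) P`, then `det Q` times the
reciprocity relation says that `S` can be moved from one factor of a convolution to the other. -/
lemma isReciprocal_of_isSymm [DecidableEq ι] {P Q : Matrix ι ι ℝ[X]} (hQ : Q.det ≠ 0)
    (hsymm : (Q.adjugate * P).IsSymm) : IsReciprocal (behavior P Q) := by
  rw [isReciprocal_iff]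
  intro iₐ vₐ i_b v_b ha hb
  rw [trajectory_mem_behavior_iff] at ha hb
  set S := Q.adjugate * P with hS
  have hmul : ∀ (A B : Matrix ι ι ℝ[X]) (w : ι → dPlus) (l : ι),
      ∑ k, A l k • ∑ j, B k j • w j = ∑ j, (A * B) l j • w j := by
    intro A B w l
    simp only [Finset.smul_sum, smul_smul, Matrix.mul_apply, Finset.sum_smul]
    exact Finset.sum_comm
  have hsolve : ∀ {i v : ι → dPlus}, (∀ k, ∑ j, P k j • i j = ∑ j, Q k j • v j) →
      ∀ l, Q.det • v l = ∑ j, S l j • i j := by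
    intro i v h l
    rw [hS, ← hmul, Finset.sum_congr rfl fun k _ => congrArg (Q.adjugate l k • ·) (h k), hmul,
      Matrix.adjugate_mul]
    simp [Matrix.one_apply]
  rw [← sub_eq_zero]
  refine eq_zero_of_poly_smul_eq_zero hQ ?_
  rw [smul_sub, sub_eq_zero, Finset.smul_sum, Finset.smul_sum]
  have e1 : ∀ j, Q.det • dPlusConv (v_b j) (iₐ j) = ∑ l, S j l • dPlusConv (i_b l) (iₐ j) := by
    intro j
    rw [← LinearMap.smul_apply, ← map_smul, hsolve hb]
    simp only [map_sum, LinearMap.sum_apply, map_smul, LinearMap.smul_apply]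
  have e2 : ∀ j, Q.det • dPlusConv (i_b j) (vₐ j) = ∑ l, S j l • dPlusConv (i_b j) (iₐ l) := by
    intro j
    rw [← map_smul, hsolve ha]
    simp only [map_sum, map_smul]
  simp only [e1, e2]
  rw [Finset.sum_comm]
  refine Finset.sum_congr rfl fun l _ => Finset.sum_congr rfl fun j _ => ?_
  rw [hsymm.apply l j]

end Reciprocity

/-! ### Projected behaviors -/

section Projection

variable {ι α β : Type*} [Fintype ι] [DecidableEq ι]

lemma mulVec_of_fromRows_eq {T₁ : Matrix α ι ℝ} {T₂ : Matrix β ι ℝ} {σ : α ⊕ β ≃ ι}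
    (hT : Matrix.fromRows T₁ T₂ = σ.toPEquiv.toMatrix) (x : ι → ℝ) :
    T₁ *ᵥ x = (fun a => x (σ (Sum.inl a))) ∧ T₂ *ᵥ x = fun b => x (σ (Sum.inr b)) := by
  have h := PEquiv.toMatrix_toPEquiv_mulVec σ x
  rw [← hT, Matrix.fromRows_mulVec] at h
  exact ⟨funext fun a => congrFun h (Sum.inl a), funext fun b => congrFun h (Sum.inr b)⟩

/-- The projection along a permutation matrix only relabels the signals and changes signs. -/
lemma mem_projection_iff {T₁ : Matrix α ι ℝ} {T₂ : Matrix β ι ℝ} {σ : α ⊕ β ≃ ι}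
    (hT : Matrix.fromRows T₁ T₂ = σ.toPEquiv.toMatrix) {B : Set ((ℝ → ι → ℝ) × (ℝ → ι → ℝ))}
    {u y : ℝ → α ⊕ β → ℝ} :
    (u, y) ∈ projection T₁ T₂ B ↔ ∃ i v : ℝ → ι → ℝ, (i, v) ∈ B ∧
      (∀ t a, u t (Sum.inl a) = i t (σ (Sum.inl a))) ∧
      (∀ t b, u t (Sum.inr b) = -v t (σ (Sum.inr b))) ∧
      (∀ t a, y t (Sum.inl a) = v t (σ (Sum.inl a))) ∧
      (∀ t b, y t (Sum.inr b) = i t (σ (Sum.inr b))) := by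
  refine exists_congr fun i => exists_congr fun v => and_congr_right fun _ => ?_
  simp only [funext_iff, mulVec_of_fromRows_eq hT, Sum.forall, Sum.elim_inl, Sum.elim_inr,
    Pi.neg_apply, forall_and, and_assoc]

/-- Reciprocity of the projected behavior implies that of the behavior. -/
lemma IsReciprocal.of_projection [Fintype α] [Fintype β] {T₁ : Matrix α ι ℝ} {T₂ : Matrix β ι ℝ}
    (hT : IsPermutationMatrix (Matrix.fromRows T₁ T₂)) {B : Set ((ℝ → ι → ℝ) × (ℝ → ι → ℝ))}
    (h : IsReciprocal (projection T₁ T₂ B)) : IsReciprocal B := by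
  obtain ⟨σ, hσ⟩ := hT
  rw [isReciprocal_iff] at h ⊢
  intro iₐ vₐ i_b v_b ha hb
  let u (i v : ι → dPlus) : α ⊕ β → dPlus :=
    Sum.elim (fun a => i (σ (Sum.inl a))) (fun b => -v (σ (Sum.inr b)))
  let y (i v : ι → dPlus) : α ⊕ β → dPlus :=
    Sum.elim (fun a => v (σ (Sum.inl a))) (fun b => i (σ (Sum.inr b)))
  have hmem : ∀ {i v : ι → dPlus}, (trajectory i, trajectory v) ∈ B →
      (trajectory (u i v), trajectory (y i v)) ∈ projection T₁ T₂ B := fun {i v} hiv =>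
    (mem_projection_iff hσ).mpr ⟨_, _, hiv, fun _ _ => rfl, fun _ _ => rfl, fun _ _ => rfl,
      fun _ _ => rfl⟩
  have h1 := h _ _ _ _ (hmem ha) (hmem hb)
  simp only [Fintype.sum_sum_type, u, y, Sum.elim_inl, Sum.elim_inr, map_neg, LinearMap.neg_apply,
    Finset.sum_neg_distrib] at h1
  rw [← σ.sum_comp, ← σ.sum_comp, Fintype.sum_sum_type, Fintype.sum_sum_type]
  rw [← sub_eq_zero] at h1 ⊢
  rw [← h1]
  abel

lemma adjointOp_neg (p : ℝ[X]) (φ : ℝ → ℝ) (t : ℝ) : adjointOp (-p) φ t = -adjointOp p φ t := by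
  simp [adjointOp, Polynomial.sum]

/-- The projected behavior is described by the matrices with exchanged columns. -/
lemma projection_behavior [Fintype α] [Fintype β] {T₁ : Matrix α ι ℝ} {T₂ : Matrix β ι ℝ}
    {σ : α ⊕ β ≃ ι} (hT : Matrix.fromRows T₁ T₂ = σ.toPEquiv.toMatrix) (S : Finset ι)
    (hl : ∀ a, σ (Sum.inl a) ∈ S) (hr : ∀ b, σ (Sum.inr b) ∉ S) (P Q : Matrix ι ι ℝ[X]) :
    projection T₁ T₂ (behavior P Q) =
      behavior ((swapLeft S P Q).submatrix σ σ) ((swapRight S P Q).submatrix σ σ) := by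
  have key : ∀ {i v : ℝ → ι → ℝ} {u y : ℝ → α ⊕ β → ℝ},
      (∀ t a, u t (Sum.inl a) = i t (σ (Sum.inl a))) →
      (∀ t b, u t (Sum.inr b) = -v t (σ (Sum.inr b))) →
      (∀ t a, y t (Sum.inl a) = v t (σ (Sum.inl a))) →
      (∀ t b, y t (Sum.inr b) = i t (σ (Sum.inr b))) →
      ((u, y) ∈ behavior ((swapLeft S P Q).submatrix σ σ) ((swapRight S P Q).submatrix σ σ) ↔
        (i, v) ∈ behavior P Q) := by
    intro i v u y h1 h2 h3 h4
    have hint : LocallyIntegrable u ∧ LocallyIntegrable y ↔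
        LocallyIntegrable i ∧ LocallyIntegrable v := by
      have hneg : ∀ b, LocallyIntegrable (fun t => -v t (σ (Sum.inr b))) ↔
          LocallyIntegrable (fun t => v t (σ (Sum.inr b))) := fun b => locallyIntegrable_neg_iff
      simp only [locallyIntegrable_pi_iff, ← σ.forall_congr_right, Sum.forall, h1, h2, h3, h4, hneg]
      tauto
    have hdist : ∀ φ k,
        distApply ((swapLeft S P Q).submatrix σ σ) u φ k -
          distApply ((swapRight S P Q).submatrix σ σ) y φ k =
        distApply P i φ (σ k) - distApply Q v φ (σ k) := by
      intro φ k
      simp only [distApply]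
      rw [← σ.sum_comp, ← σ.sum_comp, Fintype.sum_sum_type, Fintype.sum_sum_type,
        Fintype.sum_sum_type, Fintype.sum_sum_type]
      simp only [Matrix.submatrix_apply, swapLeft, swapRight, Matrix.of_apply, hl, hr, if_true,
        if_false, h1, h2, h3, h4, adjointOp_neg, neg_mul, mul_neg, integral_neg,
        Finset.sum_neg_distrib]
      ring
    have hdist' : ∀ φ, distApply ((swapLeft S P Q).submatrix σ σ) u φ =
          distApply ((swapRight S P Q).submatrix σ σ) y φ ↔
        distApply P i φ = distApply Q v φ := by
      intro φ
      rw [funext_iff, funext_iff, ← σ.forall_congr_right]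
      refine forall_congr' fun k => ?_
      rw [← sub_eq_zero, hdist, sub_eq_zero]
    simp only [behavior, Set.mem_ofPred_eq, ← and_assoc, hint, hdist']
  ext ⟨u, y⟩
  rw [mem_projection_iff hT]
  constructor
  · rintro ⟨i, v, hiv, h1, h2, h3, h4⟩
    exact (key h1 h2 h3 h4).mpr hiv
  · intro huy
    let i : ℝ → ι → ℝ := fun t j =>
      Sum.elim (fun a => u t (Sum.inl a)) (fun b => y t (Sum.inr b)) (σ.symm j)
    let v : ℝ → ι → ℝ := fun t j =>
      Sum.elim (fun a => y t (Sum.inl a)) (fun b => -u t (Sum.inr b)) (σ.symm j)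
    have h1 : ∀ t a, u t (Sum.inl a) = i t (σ (Sum.inl a)) := by simp [i]
    have h2 : ∀ t b, u t (Sum.inr b) = -v t (σ (Sum.inr b)) := by simp [v]
    have h3 : ∀ t a, y t (Sum.inl a) = v t (σ (Sum.inl a)) := by simp [v]
    have h4 : ∀ t b, y t (Sum.inr b) = i t (σ (Sum.inr b)) := by simp [i]
    exact ⟨i, v, (key h1 h2 h3 h4).mp huy, h1, h2, h3, h4⟩

lemma transferMatrix_submatrix {κ : Type*} [Fintype κ] [DecidableEq κ] (σ : κ ≃ ι)
    (P Q : Matrix ι ι ℝ[X]) :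
    transferMatrix (P.submatrix σ σ) (Q.submatrix σ σ) = (transferMatrix P Q).submatrix σ σ := by
  rw [transferMatrix, transferMatrix, ← Matrix.submatrix_map, ← Matrix.submatrix_map,
    Matrix.inv_submatrix_equiv, Matrix.submatrix_mul_equiv]

end Projection

end Behavioral

theorem theorem4p1 (n : ℕ) (P Q : Matrix (Fin n) (Fin n) ℝ[X])
    (hrank : Behavioral.normalRank (Matrix.fromCols P (-Q)) = n) :
    List.TFAE
      [ Behavioral.IsReciprocal (Behavioral.behavior P Q),
        P * Qᵀ = Q * Pᵀ,
        ∃ r : ℕ, r ≤ n ∧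
          ∃ (T₁ : Matrix (Fin r) (Fin n) ℝ) (T₂ : Matrix (Fin (n - r)) (Fin n) ℝ),
            Behavioral.IsPermutationMatrix (Matrix.fromRows T₁ T₂) ∧
            ∃ P' Q' : Matrix (Fin r ⊕ Fin (n - r)) (Fin r ⊕ Fin (n - r)) ℝ[X],
              Behavioral.projection T₁ T₂ (Behavioral.behavior P Q)
                = Behavioral.behavior P' Q' ∧
              Q'.det ≠ 0 ∧
              (∀ a b, Behavioral.IsProper (Behavioral.transferMatrix P' Q' a b)) ∧
              (Behavioral.transferMatrix P' Q').IsSymm ] := by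
  open Behavioral in
  tfae_have 1 → 2 := fun h => h.mul_transpose_comm
  tfae_have 2 → 3 := by
    intro h
    obtain ⟨S, hdet, hproper, hsymm⟩ := exists_swap_isProper P Q hrank h
    have hr : Sᶜ.card = n - S.card := by rw [Finset.card_compl, Fintype.card_fin]
    let σ := finSumEquivOfFinset (s := S) rfl hr
    refine ⟨S.card, by simpa using S.card_le_univ, (σ.toPEquiv.toMatrix).toRows₁,
      (σ.toPEquiv.toMatrix).toRows₂, ⟨σ, Matrix.fromRows_toRows _⟩, _, _,
      projection_behavior (Matrix.fromRows_toRows _) S ?_ ?_ P Q, ?_, ?_, ?_⟩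
    · intro a
      simp [σ]
    · intro b
      rw [← Finset.mem_compl]
      simp only [σ, finSumEquivOfFinset_inr]
      exact Finset.orderEmbOfFin_mem _ _ _
    · rwa [Matrix.det_submatrix_equiv_self]
    · rw [transferMatrix_submatrix]
      exact fun a b => hproper _ _
    · rw [transferMatrix_submatrix]
      exact hsymm.submatrix _
  tfae_have 3 → 1 := by
    rintro ⟨r, -, T₁, T₂, hT, P', Q', hB, hdet, -, hsymm⟩
    refine IsReciprocal.of_projection hT ?_
    rw [hB]
    exact isReciprocal_of_isSymm hdet ((transferMatrix_isSymm_iff P' Q' hdet).mp hsymm)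
  tfae_finish
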